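/- Let $H_1,H_2$ be real Hilbert spaces, $L:H_1\to H_2$ a bounded linear operator, $\lambda>0$, and let $g:H_1\to\mathbb R\cup\{\infty\}$, $f:H_2\to\mathbb R\cup\{\infty\}$ be proper, convex and lower semicontinuous. Consider the primal problem and its Fenchel dual $$(P)\quad \min_{u\in H_1}\{g(u)+f(Lu)\},\qquad (D)\quad -\min_{b\in H_2}\{g^*(-L^*b)+f^*(b)\}.$$ Assume that $(P)$ and $(D)$ both have optimal solutions, and that at least one of the following regularity conditions holds: (i) there is $x\in\operatorname{dom} g\cap\operatorname{dom}(f\circ L)$ such that $f$ is continuous at $Lx$; (ii) $0\in\operatorname{int}(L\operatorname{dom} g-\operatorname{dom} f)$. Assume moreover that $$\partial\big(g^*\circ(-L^*)\big)(b)=-L\,\partial g^*(-L^*b)\qquad\text{for all } b\in H_2,$$ and that, for the given initial values $b^0,d^0\in H_2$, the alternating split Bregman algorithm is well defined, i.e. all minimizers in the following recursion exist. Let $(u^k)_{k\ge1}$, $(d^k)_{k\ge0}$, $(b^k)_{k\ge0}$ be sequences generated by it: for every $k\ge 0$, $$u^{k+1}\in\operatorname*{argmin}_{u\in H_1}\Big\{g(u)+\tfrac\lambda2\|b^k+Lu-d^k\|^2\Big\},\quad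 d^{k+1}\in\operatorname*{argmin}_{d\in H_2}\Big\{f(d)+\tfrac\lambda2\|b^k+Lu^{k+1}-d\|^2\Big\},\quad b^{k+1}=b^k+Lu^{k+1}-d^{k+1}.$$ Then $(d^k)$ and $(b^k)$ converge weakly to some $\hat d$ and $\hat b$ in $H_2$, respectively; $\lambda\hat b$ is a solution of $(D)$; $d^k-Lu^{k+1}$ converges strongly to $0$, and $$\sum_{k=0}^\infty\|d^k-Lu^{k+1}\|^2<\infty.$$ Furthermore, $L^{-1}(\hat d)$ contains a solution $\hat u$ of $(P)$. In particular, if $L$ is injective, then $(u^k)$ has at most one weak cluster point, and any such cluster point equals $\hat u$. -/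

import Mathlib

open Filter Topology
open scoped RealInnerProductSpace Pointwise

namespace SplitBregman

noncomputable section

variable {H H₁ H₂ : Type*}
  [NormedAddCommGroup H] [InnerProductSpace ℝ H]
  [NormedAddCommGroup H₁] [InnerProductSpace ℝ H₁] [CompleteSpace H₁]
  [NormedAddCommGroup H₂] [InnerProductSpace ℝ H₂] [CompleteSpace H₂]

/-- The effective domain of an extended-real-valued function. -/
def effDom (F : H → EReal) : Set H := {x | F x < ⊤}

/-- `F` is a proper, convex, lower semicontinuous function with values in `ℝ ∪ {∞}`.
Convexity is convexity of the epigraph. -/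
structure IsProperConvexLSC (F : H → EReal) : Prop where
  ne_bot : ∀ x, F x ≠ ⊥
  exists_ne_top : ∃ x, F x ≠ ⊤
  convex_epigraph : Convex ℝ {p : H × ℝ | F p.1 ≤ (p.2 : EReal)}
  lsc : LowerSemicontinuous F

/-- `x` minimizes `F` over the whole space, and the problem is feasible. -/
def IsMinimizer (F : H → EReal) (x : H) : Prop :=
  F x ≠ ⊤ ∧ ∀ y, F x ≤ F y

/-- The Fenchel conjugate `F*(p) = sup_x (⟪p, x⟫ - F x)`, the dual of `H` being identified
with `H`. -/
def conjugate (F : H → EReal) (p : H) : EReal :=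
  ⨆ x : H, ((⟪p, x⟫ : ℝ) : EReal) - F x

/-- The convex subdifferential of `F` at `x`; it is empty unless `F x` is finite. -/
def subdifferential (F : H → EReal) (x : H) : Set H :=
  {p | F x ≠ ⊤ ∧ F x ≠ ⊥ ∧ ∀ y, F x + ((⟪p, y - x⟫ : ℝ) : EReal) ≤ F y}

/-- The objective `u ↦ g u + f (L u)` of the primal problem. -/
def primalObjective (g : H₁ → EReal) (f : H₂ → EReal) (L : H₁ →L[ℝ] H₂) (u : H₁) : EReal :=
  g u + f (L u)

/-- The function `b ↦ g* (-L* b)`. -/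
def conjugateCompNegAdjoint (g : H₁ → EReal) (L : H₁ →L[ℝ] H₂) (b : H₂) : EReal :=
  conjugate g (-(ContinuousLinearMap.adjoint L b))

/-- The function `b ↦ g* (-L* b) + f* b` minimized in the Fenchel dual problem. -/
def dualObjective (g : H₁ → EReal) (f : H₂ → EReal) (L : H₁ →L[ℝ] H₂) (b : H₂) : EReal :=
  conjugateCompNegAdjoint g L b + conjugate f b

/-- The chain rule `∂(g* ∘ (-L*))(b) = -L ∂g*(-L* b)` for all `b`. -/
def ChainRule (g : H₁ → EReal) (L : H₁ →L[ℝ] H₂) : Prop :=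
  ∀ b : H₂, subdifferential (conjugateCompNegAdjoint g L) b =
    (fun u => -(L u)) '' subdifferential (conjugate g) (-(ContinuousLinearMap.adjoint L b))

/-- The regularity condition for Fenchel duality: either `f` is continuous at `L x` for some
`x ∈ dom g ∩ dom (f ∘ L)`, or `0 ∈ int (L (dom g) - dom f)`. -/
def RegularityCondition (g : H₁ → EReal) (f : H₂ → EReal) (L : H₁ →L[ℝ] H₂) : Prop :=
  (∃ x, x ∈ effDom g ∧ L x ∈ effDom f ∧ ContinuousAt f (L x)) ∨
    (0 : H₂) ∈ interior (L '' effDom g - effDom f)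

/-- `u`, `d`, `b` are generated by the alternating split Bregman algorithm with parameter `lam`
and initial values `b 0`, `d 0`; in particular every subproblem along the way has a minimizer.
The term `u 0` is not part of the algorithm and is unconstrained. -/
structure IsAlternatingSplitBregman (g : H₁ → EReal) (f : H₂ → EReal) (L : H₁ →L[ℝ] H₂)
    (lam : ℝ) (u : ℕ → H₁) (d b : ℕ → H₂) : Prop where
  u_step : ∀ k, IsMinimizer
    (fun v : H₁ => g v + ((lam / 2 * ‖b k + L v - d k‖ ^ 2 : ℝ) : EReal)) (u (k + 1))
  d_step : ∀ k, IsMinimizer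
    (fun e : H₂ => f e + ((lam / 2 * ‖b k + L (u (k + 1)) - e‖ ^ 2 : ℝ) : EReal)) (d (k + 1))
  b_step : ∀ k, b (k + 1) = b k + L (u (k + 1)) - d (k + 1)

/-- Weak convergence of a sequence. -/
def WeaklyConverges (x : ℕ → H) (a : H) : Prop :=
  Tendsto (fun k => toWeakSpace ℝ H (x k)) atTop (𝓝 (toWeakSpace ℝ H a))

/-- `a` is a cluster point of the sequence `x` in the weak topology. -/
def IsWeakClusterPt (x : ℕ → H) (a : H) : Prop :=
  MapClusterPt (toWeakSpace ℝ H a) atTop (fun k => toWeakSpace ℝ H (x k))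

end

end SplitBregman

/-! By regularity, a primal solution has a multiplier, so a KKT pair (v, λc) exists
(`exists_isSaddle`). Fermat's rule puts λb^{k+1} in ∂f(d^{k+1}) and -L*(λ(b^k + r^k)) in
∂g(u^{k+1}), where r^k = Lu^{k+1} - d^k. Monotonicity of the subdifferentials against the KKT pair
makes ‖b^k - c‖² + ‖d^k - Lv‖² drop by at least ‖r^k‖² per step (`fejer`). Hence the residuals are
square summable, the iterates are bounded, and their distance to every KKT pair converges.

Bounded iterates have weak limits along ultrafilters. `exists_isSaddle_of_weak_limit` shows that
these are KKT pairs: adding the subgradient inequalities for f and for g* ∘ (-L*) cancels the only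
product of two weakly convergent sequences, λ⟨b^k, d^k⟩, up to terms killed by r^k → 0. The chain
rule turns the limiting inclusion into a point v with Lv = d̂. Opial's argument
(`weak_limit_unique`) identifies all limits. No convergence of (u^k) enters. -/

namespace SplitBregman

/-! ### Subgradients, conjugates and affine minorants -/

section ConvexAnalysis

variable {H : Type*} [NormedAddCommGroup H] [InnerProductSpace ℝ H]

theorem mem_subdifferential_iff {F : H → EReal} {x p : H} :
    p ∈ subdifferential F x ↔
      ∃ r : ℝ, F x = r ∧ ∀ y, ((r + ⟪p, y - x⟫ : ℝ) : EReal) ≤ F y := by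
  constructor
  · rintro ⟨h1, h2, h3⟩
    refine ⟨(F x).toReal, (EReal.coe_toReal h1 h2).symm, fun y => ?_⟩
    have := h3 y
    rwa [← EReal.coe_toReal h1 h2, ← EReal.coe_add] at this
  · rintro ⟨r, hr, h⟩
    refine ⟨by simp [hr], by simp [hr], fun y => ?_⟩
    rw [hr, ← EReal.coe_add]
    exact h y

theorem inner_sub_nonneg_of_mem_subdifferential {F : H → EReal} {x y p q : H}
    (hp : p ∈ subdifferential F x) (hq : q ∈ subdifferential F y) : 0 ≤ ⟪p - q, x - y⟫ := by
  obtain ⟨r, hr, h1⟩ := mem_subdifferential_iff.1 hp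
  obtain ⟨s, hs, h2⟩ := mem_subdifferential_iff.1 hq
  have h3 := h1 y
  have h4 := h2 x
  rw [hs, EReal.coe_le_coe_iff] at h3
  rw [hr, EReal.coe_le_coe_iff] at h4
  have h5 : ⟪p - q, x - y⟫ = -⟪p, y - x⟫ - ⟪q, x - y⟫ := by
    simp only [inner_sub_left, inner_sub_right]
    ring
  linarith

/-- The Fenchel–Young inequality, in terms of a finite value of the function. -/
theorem le_conjugate_of_eq {F : H → EReal} {x : H} {r : ℝ} (h : F x = r) (p : H) :
    ((⟪p, x⟫ - r : ℝ) : EReal) ≤ conjugate F p := by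
  have := le_iSup (fun y : H => ((⟪p, y⟫ : ℝ) : EReal) - F y) x
  simpa only [h, EReal.coe_sub, conjugate] using this

theorem conjugate_le_of_affine_le {F : H → EReal} {p : H} {c : ℝ}
    (h : ∀ y, ((⟪p, y⟫ + c : ℝ) : EReal) ≤ F y) : conjugate F p ≤ ((-c : ℝ) : EReal) := by
  refine iSup_le fun y => ?_
  have hy := h y
  induction hF : F y with
  | bot => rw [hF] at hy; simp at hy
  | top => simp
  | coe a =>
    rw [hF] at hy
    rw [← EReal.coe_sub]
    have := EReal.coe_le_coe_iff.1 hy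
    exact EReal.coe_le_coe_iff.2 (by linarith)

theorem affine_le_of_conjugate_eq {F : H → EReal} (hF : ∀ x, F x ≠ ⊥) {p : H} {c : ℝ}
    (h : conjugate F p = c) (y : H) : ((⟪p, y⟫ - c : ℝ) : EReal) ≤ F y := by
  induction hy : F y with
  | bot => exact absurd hy (hF y)
  | top => simp
  | coe a =>
    have := le_conjugate_of_eq hy p
    rw [h] at this
    have := EReal.coe_le_coe_iff.1 this
    exact EReal.coe_le_coe_iff.2 (by linarith)

theorem conjugate_eq_of_mem_subdifferential {F : H → EReal} {x p : H} {r : ℝ} (hr : F x = r)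
    (hp : p ∈ subdifferential F x) : conjugate F p = ((⟪p, x⟫ - r : ℝ) : EReal) := by
  refine le_antisymm ?_ (le_conjugate_of_eq hr p)
  obtain ⟨s, hs, h⟩ := mem_subdifferential_iff.1 hp
  obtain rfl : r = s := EReal.coe_eq_coe_iff.1 (hr.symm.trans hs)
  have := conjugate_le_of_affine_le (F := F) (p := p) (c := r - ⟪p, x⟫) fun y => by
    have := h y
    rw [inner_sub_right] at this
    convert this using 2
    ring
  simpa using this

theorem conjugate_ne_bot {F : H → EReal} (hF : IsProperConvexLSC F) (p : H) :
    conjugate F p ≠ ⊥ := by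
  obtain ⟨x, hx⟩ := hF.exists_ne_top
  have := le_conjugate_of_eq (EReal.coe_toReal hx (hF.ne_bot x)).symm p
  intro h
  rw [h] at this
  exact EReal.coe_ne_bot _ (le_bot_iff.1 this)

theorem IsProperConvexLSC.convex_combination_le {F : H → EReal} (hF : IsProperConvexLSC F)
    {x y : H} {r s : ℝ} (hx : F x ≤ r) (hy : F y ≤ s) {a b : ℝ} (ha : 0 ≤ a) (hb : 0 ≤ b)
    (hab : a + b = 1) : F (a • x + b • y) ≤ ((a * r + b * s : ℝ) : EReal) :=
  hF.convex_epigraph (x := (x, r)) hx (y := (y, s)) hy ha hb hab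

theorem IsProperConvexLSC.isClosed_epigraph {F : H → EReal} (hF : IsProperConvexLSC F) :
    IsClosed {p : H × ℝ | F p.1 ≤ (p.2 : EReal)} := by
  have := hF.lsc.isClosed_epigraph
  exact this.preimage (f := fun p : H × ℝ => (p.1, (p.2 : EReal)))
    (continuous_fst.prodMk (continuous_coe_real_ereal.comp continuous_snd))

/-- A separating hyperplane that is not vertical can be solved for the height, so it is the graph of
an affine minorant. -/
theorem affine_le_of_separating {F : H → EReal} (hF : ∀ x, F x ≠ ⊥) {q : H} {s c : ℝ}
    (hs : 0 < s) (h : ∀ y (t : ℝ), F y ≤ t → c < ⟪q, y⟫ + s * t) (y : H) :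
    ((⟪(-s⁻¹) • q, y⟫ + s⁻¹ * c : ℝ) : EReal) ≤ F y := by
  induction hy : F y with
  | bot => exact absurd hy (hF y)
  | top => simp
  | coe r =>
    have := h y r hy.le
    refine EReal.coe_le_coe_iff.2 ?_
    rw [real_inner_smul_left]
    have h2 : s⁻¹ * c ≤ s⁻¹ * (⟪q, y⟫ + s * r) := by gcongr
    have h3 : s⁻¹ * (⟪q, y⟫ + s * r) = s⁻¹ * ⟪q, y⟫ + r := by field_simp
    linarith

variable [CompleteSpace H]

theorem exists_inner_add_mul (φ : StrongDual ℝ (H × ℝ)) :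
    ∃ (q : H) (s : ℝ), ∀ y t, φ (y, t) = ⟪q, y⟫ + s * t := by
  refine ⟨(InnerProductSpace.toDual ℝ H).symm (φ.comp (ContinuousLinearMap.inl ℝ H ℝ)),
    φ (0, 1), fun y t => ?_⟩
  have h : ((y, t) : H × ℝ) = (y, 0) + t • (0, 1) := by simp
  rw [h, map_add, map_smul]
  simp [mul_comm]

/-- A point strictly below the graph is strictly separated from the epigraph. -/
theorem IsProperConvexLSC.exists_separating {F : H → EReal} (hF : IsProperConvexLSC F)
    {x : H} {a : ℝ} (ha : (a : EReal) < F x) :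
    ∃ (q : H) (s c : ℝ), 0 ≤ s ∧ ⟪q, x⟫ + s * a < c ∧
      ∀ y (t : ℝ), F y ≤ t → c < ⟪q, y⟫ + s * t := by
  obtain ⟨φ, c, h1, h2⟩ := geometric_hahn_banach_point_closed hF.convex_epigraph
    hF.isClosed_epigraph (x := (x, a)) (by simpa using ha)
  obtain ⟨q, s, hφ⟩ := exists_inner_add_mul φ
  rw [hφ] at h1
  have h3 : ∀ y (t : ℝ), F y ≤ t → c < ⟪q, y⟫ + s * t := fun y t h => by
    rw [← hφ]; exact h2 (y, t) h
  refine ⟨q, s, c, ?_, h1, h3⟩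
  by_contra! hs
  obtain ⟨x₀, hx₀⟩ := hF.exists_ne_top
  have hr := EReal.coe_toReal hx₀ (hF.ne_bot x₀)
  -- The epigraph is unbounded upwards: if s < 0, the height T over x₀ already brings the functional
  -- down to c.
  set r := (F x₀).toReal
  set T := max r ((c - ⟪q, x₀⟫) / s)
  have hT := h3 x₀ T (by rw [← hr]; exact EReal.coe_le_coe_iff.2 (le_max_left _ _))
  have : (c - ⟪q, x₀⟫) / s ≤ T := le_max_right _ _
  rw [div_le_iff_of_neg hs] at this
  linarith [mul_comm s T]

theorem IsProperConvexLSC.exists_affine_minorant {F : H → EReal} (hF : IsProperConvexLSC F) :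
    ∃ (p : H) (c : ℝ), ∀ y, ((⟪p, y⟫ + c : ℝ) : EReal) ≤ F y := by
  obtain ⟨x, hx⟩ := hF.exists_ne_top
  have hr := EReal.coe_toReal hx (hF.ne_bot x)
  set r := (F x).toReal
  -- Separating a point below the graph over the domain rules out a vertical hyperplane: s = 0 would
  -- give c < ⟪q, x⟫ < c.
  obtain ⟨q, s, c, hs, h1, h2⟩ := hF.exists_separating (x := x) (a := r - 1)
    (by rw [← hr]; exact EReal.coe_lt_coe_iff.2 (by linarith))
  have h3 := h2 x r hr.ge
  have hs' : 0 < s := by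
    rcases hs.eq_or_lt with rfl | h
    · linarith
    · exact h
  exact ⟨_, _, affine_le_of_separating hF.ne_bot hs' h2⟩

/-- A proper convex lower semicontinuous function is the supremum of its affine minorants. -/
theorem IsProperConvexLSC.exists_affine_minorant_gt {F : H → EReal} (hF : IsProperConvexLSC F)
    {x : H} {a : ℝ} (ha : (a : EReal) < F x) :
    ∃ (p : H) (c : ℝ), (∀ y, ((⟪p, y⟫ + c : ℝ) : EReal) ≤ F y) ∧ a < ⟪p, x⟫ + c := by
  obtain ⟨q, s, c, hs, h1, h2⟩ := hF.exists_separating ha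
  rcases hs.eq_or_lt with rfl | hs
  -- Vertical hyperplane: c - ⟪q, ·⟫ is negative on the domain and positive at x, so adding a large
  -- multiple of it to any affine minorant keeps a minorant and lifts its value at x above a.
  · obtain ⟨p, c₀, h₀⟩ := hF.exists_affine_minorant
    have hgap : 0 < c - ⟪q, x⟫ := by linarith
    obtain ⟨n, hn⟩ := exists_nat_gt ((a - ⟪p, x⟫ - c₀) / (c - ⟪q, x⟫))
    rw [div_lt_iff₀ hgap] at hn
    refine ⟨p - (n : ℝ) • q, c₀ + n * c, fun y => ?_, ?_⟩
    · induction hy : F y with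
      | bot => exact absurd hy (hF.ne_bot y)
      | top => simp
      | coe r =>
        have h3 := h2 y r hy.le
        have h4 := h₀ y
        rw [hy, EReal.coe_le_coe_iff] at h4
        refine EReal.coe_le_coe_iff.2 ?_
        rw [inner_sub_left, real_inner_smul_left]
        nlinarith [(Nat.cast_nonneg n : (0 : ℝ) ≤ n)]
    · rw [inner_sub_left, real_inner_smul_left]
      linarith
  · refine ⟨_, _, affine_le_of_separating hF.ne_bot hs h2, ?_⟩
    rw [real_inner_smul_left]
    have h3 : s⁻¹ * (⟪q, x⟫ + s * a) < s⁻¹ * c := by gcongr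
    have h4 : s⁻¹ * (⟪q, x⟫ + s * a) = s⁻¹ * ⟪q, x⟫ + a := by field_simp
    linarith

/-- Subgradients of the conjugate are inverse to subgradients of the function. -/
theorem IsProperConvexLSC.mem_subdifferential_of_conjugate {F : H → EReal}
    (hF : IsProperConvexLSC F) {x p : H} (h : x ∈ subdifferential (conjugate F) p) :
    p ∈ subdifferential F x := by
  obtain ⟨κ, hκ, h⟩ := mem_subdifferential_iff.1 h
  have h1 := affine_le_of_conjugate_eq hF.ne_bot hκ
  -- Otherwise some affine minorant with slope q and constant c exceeds ⟪p, x⟫ - κ at x; then F*(q)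
  -- ≤ -c violates the subgradient inequality for F* at q.
  have h2 : F x ≤ ((⟪p, x⟫ - κ : ℝ) : EReal) := by
    by_contra! hlt
    obtain ⟨q, c, hq, hx⟩ := hF.exists_affine_minorant_gt hlt
    have := (h q).trans (conjugate_le_of_affine_le hq)
    rw [EReal.coe_le_coe_iff, inner_sub_right, real_inner_comm, real_inner_comm p x] at this
    linarith
  refine mem_subdifferential_iff.2 ⟨⟪p, x⟫ - κ, le_antisymm h2 (h1 x), fun y => ?_⟩
  convert h1 y using 2
  rw [inner_sub_right]
  ring

end ConvexAnalysis

/-! ### Weak limits, weak lower semicontinuity and Opial's lemma -/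

section WeakConvergence

variable {H : Type*} [NormedAddCommGroup H] [InnerProductSpace ℝ H] {ι : Type*}

/-- A conjugate is a supremum of weakly continuous affine functions, hence weakly lower
semicontinuous. -/
theorem eventually_lt_conjugate {F : H → EReal} (hF : ∀ x, F x ≠ ⊥)
    {l : Filter ι} {x : ι → H} {a : H} (hx : ∀ h, Tendsto (fun i => ⟪h, x i⟫) l (𝓝 ⟪h, a⟫))
    {r : EReal} (hr : r < conjugate F a) : ∀ᶠ i in l, r < conjugate F (x i) := by
  obtain ⟨y, hy⟩ := lt_iSup_iff.1 hr
  induction hFy : F y with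
  | bot => exact absurd hFy (hF y)
  | top => simp [hFy] at hy
  | coe t =>
    rw [hFy, ← EReal.coe_sub] at hy
    have h1 : Tendsto (fun i => ((⟪x i, y⟫ - t : ℝ) : EReal)) l (𝓝 ((⟪a, y⟫ - t : ℝ) : EReal)) := by
      refine (continuous_coe_real_ereal.tendsto _).comp (Tendsto.sub_const ?_ t)
      simpa only [real_inner_comm] using hx y
    filter_upwards [h1.eventually_const_lt hy] with i hi
    exact hi.trans_le (le_conjugate_of_eq hFy _)

/-- Opial's lemma for a pair of sequences: two weak limits, along filters, with respect to which
the summed squared distances converge, agree. -/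
theorem weak_limit_unique {b d : ℕ → H} {l₁ l₂ : Filter ℕ} [l₁.NeBot] [l₂.NeBot]
    (hl₁ : l₁ ≤ atTop) (hl₂ : l₂ ≤ atTop) {b₁ b₂ d₁ d₂ : H}
    (hb₁ : ∀ h, Tendsto (fun k => ⟪h, b k⟫) l₁ (𝓝 ⟪h, b₁⟫))
    (hd₁ : ∀ h, Tendsto (fun k => ⟪h, d k⟫) l₁ (𝓝 ⟪h, d₁⟫))
    (hb₂ : ∀ h, Tendsto (fun k => ⟪h, b k⟫) l₂ (𝓝 ⟪h, b₂⟫))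
    (hd₂ : ∀ h, Tendsto (fun k => ⟪h, d k⟫) l₂ (𝓝 ⟪h, d₂⟫))
    {m₁ m₂ : ℝ} (h₁ : Tendsto (fun k => ‖b k - b₁‖ ^ 2 + ‖d k - d₁‖ ^ 2) atTop (𝓝 m₁))
    (h₂ : Tendsto (fun k => ‖b k - b₂‖ ^ 2 + ‖d k - d₂‖ ^ 2) atTop (𝓝 m₂)) :
    b₁ = b₂ ∧ d₁ = d₂ := by
  -- In the difference of the two squared distances the quadratic terms cancel, leaving this linear
  -- functional of (b k, d k), which therefore converges. Equating its limits along the two filters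
  -- makes the distance between the limit pairs vanish.
  have h3 : Tendsto (fun k => ⟪b₂ - b₁, b k⟫ + ⟪d₂ - d₁, d k⟫) atTop
      (𝓝 ((m₁ - m₂ - (‖b₁‖ ^ 2 + ‖d₁‖ ^ 2 - ‖b₂‖ ^ 2 - ‖d₂‖ ^ 2)) / 2)) := by
    refine (((h₁.sub h₂).sub_const _).div_const 2).congr fun k => ?_
    simp only [norm_sub_sq_real, inner_sub_left]
    rw [real_inner_comm b₁, real_inner_comm b₂, real_inner_comm d₁, real_inner_comm d₂]
    ring
  have e1 := tendsto_nhds_unique ((hb₁ (b₂ - b₁)).add (hd₁ (d₂ - d₁))) (h3.mono_left hl₁)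
  have e2 := tendsto_nhds_unique ((hb₂ (b₂ - b₁)).add (hd₂ (d₂ - d₁))) (h3.mono_left hl₂)
  have e3 : ‖b₂ - b₁‖ ^ 2 + ‖d₂ - d₁‖ ^ 2 = 0 := by
    rw [← real_inner_self_eq_norm_sq, ← real_inner_self_eq_norm_sq, inner_sub_right (b₂ - b₁),
      inner_sub_right (d₂ - d₁)]
    linarith
  constructor
  · have : ‖b₂ - b₁‖ = 0 := by nlinarith [sq_nonneg ‖b₂ - b₁‖, sq_nonneg ‖d₂ - d₁‖]
    exact (sub_eq_zero.1 (norm_eq_zero.1 this)).symm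
  · have : ‖d₂ - d₁‖ = 0 := by nlinarith [sq_nonneg ‖b₂ - b₁‖, sq_nonneg ‖d₂ - d₁‖]
    exact (sub_eq_zero.1 (norm_eq_zero.1 this)).symm

variable [CompleteSpace H]

/-- Weak lower semicontinuity: an affine minorant above r at a is weakly continuous, so it stays
above r. -/
theorem IsProperConvexLSC.eventually_lt {F : H → EReal} (hF : IsProperConvexLSC F)
    {l : Filter ι} {x : ι → H} {a : H} (hx : ∀ h, Tendsto (fun i => ⟪h, x i⟫) l (𝓝 ⟪h, a⟫))
    {r : EReal} (hr : r < F a) : ∀ᶠ i in l, r < F (x i) := by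
  obtain ⟨s, hrs, hs⟩ := EReal.lt_iff_exists_real_btwn.1 hr
  obtain ⟨p, c, hp, hlt⟩ := hF.exists_affine_minorant_gt hs
  filter_upwards [((hx p).add_const c).eventually_const_lt hlt] with i hi
  exact hrs.trans ((EReal.coe_lt_coe_iff.2 hi).trans_le (hp _))

theorem add_le_of_eventually {l : Filter ι} [l.NeBot] {A B : EReal} {φ ψ : ι → EReal}
    {c : ι → ℝ} {γ : ℝ} (hc : Tendsto c l (𝓝 γ)) (hφ : ∀ r < A, ∀ᶠ i in l, r < φ i)
    (hψ : ∀ r < B, ∀ᶠ i in l, r < ψ i) (h : ∀ᶠ i in l, φ i + ψ i ≤ c i) : A + B ≤ γ := by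
  refine EReal.add_le_of_forall_lt fun r hr s hs => ?_
  refine ge_of_tendsto ((continuous_coe_real_ereal.tendsto γ).comp hc) ?_
  filter_upwards [hφ r hr, hψ s hs, h] with i h1 h2 h3
  exact (add_le_add h1.le h2.le).trans h3

/-- Weak compactness of balls, along ultrafilters. -/
theorem exists_weak_limit (U : Ultrafilter ι) {x : ι → H} {R : ℝ}
    (hx : ∀ᶠ i in (U : Filter ι), ‖x i‖ ≤ R) :
    ∃ a : H, ∀ h, Tendsto (fun i => ⟪h, x i⟫) (U : Filter ι) (𝓝 ⟪h, a⟫) := by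
  have hK := WeakDual.isCompact_closedBall (𝕜 := ℝ) (0 : StrongDual ℝ H) R
  let ξ : ι → WeakDual ℝ H := fun i => StrongDual.toWeakDual (InnerProductSpace.toDual ℝ H (x i))
  obtain ⟨φ, -, hφ⟩ := isCompact_iff_ultrafilter_le_nhds.1 hK (U.map ξ) (by
    rw [le_principal_iff]
    change ∀ᶠ i in (U : Filter ι), _
    filter_upwards [hx] with i hi
    simpa [ξ] using hi)
  refine ⟨(InnerProductSpace.toDual ℝ H).symm (WeakDual.toStrongDual φ), fun h => ?_⟩
  have h1 : Tendsto (fun i => ξ i h) (U : Filter ι) (𝓝 (φ h)) :=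
    ((WeakDual.eval_continuous h).tendsto φ).comp hφ
  convert h1 using 2
  · simp [ξ, real_inner_comm]
  · rw [real_inner_comm, InnerProductSpace.toDual_symm_apply]
    simp

theorem weaklyConverges_of_forall_inner {x : ℕ → H} {a : H}
    (h : ∀ y, Tendsto (fun k => ⟪y, x k⟫) atTop (𝓝 ⟪y, a⟫)) : WeaklyConverges x a := by
  refine (WeakBilin.tendsto_iff_forall_eval_tendsto _ ?_).2 fun φ => ?_
  · intro v w hvw
    refine ext_inner_left ℝ fun y => ?_
    exact LinearMap.congr_fun hvw (InnerProductSpace.toDual ℝ H y)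
  · have := h ((InnerProductSpace.toDual ℝ H).symm φ)
    simp only [InnerProductSpace.toDual_symm_apply] at this
    exact this

theorem IsWeakClusterPt.mapClusterPt_inner {x : ℕ → H} {a : H} (h : IsWeakClusterPt x a) (y : H) :
    MapClusterPt ⟪y, a⟫ atTop (fun k => ⟪y, x k⟫) := by
  let φ : StrongDual ℝ H := InnerProductSpace.toDual ℝ H y
  have hφ : Continuous fun z : WeakSpace ℝ H => φ ((toWeakSpace ℝ H).symm z) :=
    WeakBilin.eval_continuous (topDualPairing ℝ H).flip φ
  exact MapClusterPt.continuousAt_comp (X := WeakSpace ℝ H) hφ.continuousAt h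

end WeakConvergence

/-! ### KKT pairs and existence of multipliers -/

section Duality

variable {H₁ H₂ : Type*}
  [NormedAddCommGroup H₁] [InnerProductSpace ℝ H₁]
  [NormedAddCommGroup H₂] [InnerProductSpace ℝ H₂]
  {g : H₁ → EReal} {f : H₂ → EReal} {L : H₁ →L[ℝ] H₂}

theorem exists_coe_of_add_le {A B : EReal} (hA : A ≠ ⊥) (hB : B ≠ ⊥) {t : ℝ} (h : A + B ≤ t) :
    ∃ r s : ℝ, A = r ∧ B = s ∧ r + s ≤ t := by
  induction A with
  | bot => exact absurd rfl hA
  | top => rw [EReal.top_add_of_ne_bot hB] at h; simp at h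
  | coe r =>
    induction B with
    | bot => exact absurd rfl hB
    | top => rw [EReal.coe_add_top] at h; simp at h
    | coe s => exact ⟨r, s, rfl, rfl, by exact_mod_cast h⟩

/-- Joint convexity of (u, y) ↦ g u + f (L u + y), phrased with real upper bounds so that infinite
values never need arithmetic. -/
theorem perturbed_convex_combination_le (hg : IsProperConvexLSC g) (hf : IsProperConvexLSC f)
    {u v : H₁} {y z : H₂} {s t : ℝ} (hu : g u + f (L u + y) ≤ s) (hv : g v + f (L v + z) ≤ t)
    {a b : ℝ} (ha : 0 ≤ a) (hb : 0 ≤ b) (hab : a + b = 1) :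
    g (a • u + b • v) + f (L (a • u + b • v) + (a • y + b • z)) ≤
      ((a * s + b * t : ℝ) : EReal) := by
  obtain ⟨r₁, s₁, h1, h2, h3⟩ := exists_coe_of_add_le (hg.ne_bot _) (hf.ne_bot _) hu
  obtain ⟨r₂, s₂, h4, h5, h6⟩ := exists_coe_of_add_le (hg.ne_bot _) (hf.ne_bot _) hv
  have h7 := hg.convex_combination_le h1.le h4.le ha hb hab
  have h8 := hf.convex_combination_le h2.le h5.le ha hb hab
  have h9 : L (a • u + b • v) + (a • y + b • z) = a • (L u + y) + b • (L v + z) := by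
    simp only [map_add, map_smul, smul_add]
    abel
  rw [h9]
  refine (add_le_add h7 h8).trans ?_
  rw [← EReal.coe_add, EReal.coe_le_coe_iff]
  nlinarith [mul_le_mul_of_nonneg_left h3 ha, mul_le_mul_of_nonneg_left h6 hb]

/-- The perturbations for which the perturbed primal problem has a point of norm at most `R`
and value at most `R`. -/
def boundedPerturbations (g : H₁ → EReal) (f : H₂ → EReal) (L : H₁ →L[ℝ] H₂) (R : ℝ) : Set H₂ :=
  {y | ∃ u, ‖u‖ ≤ R ∧ g u + f (L u + y) ≤ R}

theorem boundedPerturbations_mono {R S : ℝ} (h : R ≤ S) :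
    boundedPerturbations g f L R ⊆ boundedPerturbations g f L S := by
  rintro y ⟨u, hu, hy⟩
  exact ⟨u, hu.trans h, hy.trans (EReal.coe_le_coe_iff.2 h)⟩

theorem convex_boundedPerturbations (hg : IsProperConvexLSC g) (hf : IsProperConvexLSC f) (R : ℝ) :
    Convex ℝ (boundedPerturbations g f L R) := by
  rintro y ⟨u, hu, hy⟩ z ⟨v, hv, hz⟩ a b ha hb hab
  refine ⟨a • u + b • v, ?_, ?_⟩
  · have := convex_closedBall (0 : H₁) R (x := u) (by simpa using hu) (y := v) (by simpa using hv)
      ha hb hab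
    simpa using this
  · have := perturbed_convex_combination_le hg hf hy hz ha hb hab
    rwa [← add_mul, hab, one_mul] at this

/-- Continuity at L x keeps f below ⊤ nearby, so the first alternative implies the second. -/
theorem RegularityCondition.mem_interior (h : RegularityCondition g f L) :
    (0 : H₂) ∈ interior (L '' effDom g - effDom f) := by
  rcases h with ⟨x, hx, hLx, hc⟩ | h
  · rw [mem_interior_iff_mem_nhds]
    have h1 : ∀ᶠ y in 𝓝 (L x), y ∈ effDom f := hc.eventually_lt_const hLx
    have h2 : Tendsto (fun y => L x - y) (𝓝 (0 : H₂)) (𝓝 (L x)) := by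
      have : Continuous fun y : H₂ => L x - y := by fun_prop
      simpa using this.tendsto 0
    filter_upwards [h2.eventually h1] with y hy
    exact ⟨L x, ⟨x, hx, rfl⟩, L x - y, hy, by simp⟩
  · exact h

theorem exists_mem_boundedPerturbations (hg : IsProperConvexLSC g) (hf : IsProperConvexLSC f)
    {y : H₂} (hy : -y ∈ L '' effDom g - effDom f) : ∃ n : ℕ, y ∈ boundedPerturbations g f L n := by
  obtain ⟨_, ⟨u, hu, rfl⟩, z, hz, hyz⟩ := hy
  have hr := EReal.coe_toReal hu.ne (hg.ne_bot u)
  have hs := EReal.coe_toReal hz.ne (hf.ne_bot z)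
  obtain ⟨n, hn⟩ := exists_nat_ge (max ‖u‖ ((g u).toReal + (f z).toReal))
  have hz' : L u + y = z := by
    have : L u - z = -y := hyz
    rw [← neg_eq_iff_eq_neg.2 this.symm.symm]
    abel
  refine ⟨n, u, (le_max_left _ _).trans hn, ?_⟩
  rw [hz', ← hr, ← hs, ← EReal.coe_add, EReal.coe_le_coe_iff]
  exact (le_max_right _ _).trans hn

variable [CompleteSpace H₁] [CompleteSpace H₂]

/-- The Karush–Kuhn–Tucker conditions for the primal-dual pair `(u, p)`. -/
structure IsSaddle (g : H₁ → EReal) (f : H₂ → EReal) (L : H₁ →L[ℝ] H₂) (u : H₁) (p : H₂) :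
    Prop where
  left : -(ContinuousLinearMap.adjoint L p) ∈ subdifferential g u
  right : p ∈ subdifferential f (L u)

theorem IsSaddle.isMinimizer_primal {u : H₁} {p : H₂} (h : IsSaddle g f L u p) :
    IsMinimizer (primalObjective g f L) u := by
  obtain ⟨r, hr, h1⟩ := mem_subdifferential_iff.1 h.left
  obtain ⟨s, hs, h2⟩ := mem_subdifferential_iff.1 h.right
  refine ⟨?_, fun v => ?_⟩
  · rw [primalObjective, hr, hs, ← EReal.coe_add]
    exact EReal.coe_ne_top _
  · refine le_trans (le_of_eq ?_) (add_le_add (h1 v) (h2 (L v)))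
    rw [primalObjective, hr, hs, ← EReal.coe_add, ← EReal.coe_add, inner_neg_left,
      ContinuousLinearMap.adjoint_inner_left, map_sub]
    congr 1
    ring

theorem IsSaddle.isMinimizer_dual {u : H₁} {p : H₂} (h : IsSaddle g f L u p) :
    IsMinimizer (dualObjective g f L) p := by
  obtain ⟨r, hr, -⟩ := mem_subdifferential_iff.1 h.left
  obtain ⟨s, hs, -⟩ := mem_subdifferential_iff.1 h.right
  have h1 := conjugate_eq_of_mem_subdifferential hr h.left
  have h2 := conjugate_eq_of_mem_subdifferential hs h.right
  have h3 : dualObjective g f L p = ((-r - s : ℝ) : EReal) := by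
    rw [dualObjective, conjugateCompNegAdjoint, h1, h2, ← EReal.coe_add, inner_neg_left,
      ContinuousLinearMap.adjoint_inner_left]
    congr 1
    ring
  refine ⟨by rw [h3]; exact EReal.coe_ne_top _, fun q => ?_⟩
  rw [h3]
  refine le_trans (le_of_eq ?_) (add_le_add
    (le_conjugate_of_eq hr (-(ContinuousLinearMap.adjoint L q))) (le_conjugate_of_eq hs q))
  rw [← EReal.coe_add, inner_neg_left, ContinuousLinearMap.adjoint_inner_left]
  congr 1
  ring

/-- The norm bound is what makes this true: the witnesses have a weak limit along an ultrafilter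
tending to y, and weak lower semicontinuity carries both bounds over to it. -/
theorem isClosed_boundedPerturbations (hg : IsProperConvexLSC g) (hf : IsProperConvexLSC f)
    (R : ℝ) : IsClosed (boundedPerturbations g f L R) := by
  rw [← closure_subset_iff_isClosed]
  intro y hy
  obtain ⟨U, hU, hUy⟩ := mem_closure_iff_ultrafilter.1 hy
  have hch : ∀ z, ∃ u, z ∈ boundedPerturbations g f L R → ‖u‖ ≤ R ∧ g u + f (L u + z) ≤ R := by
    intro z
    by_cases hz : z ∈ boundedPerturbations g f L R
    · obtain ⟨u, hu⟩ := hz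
      exact ⟨u, fun _ => hu⟩
    · exact ⟨0, fun h => absurd h hz⟩
  choose u hu using hch
  have hbd : ∀ᶠ z in (U : Filter H₂), ‖u z‖ ≤ R := by
    filter_upwards [hU] with z hz using (hu z hz).1
  obtain ⟨a, ha⟩ := exists_weak_limit U hbd
  have hy' : Tendsto (fun z : H₂ => z) (U : Filter H₂) (𝓝 y) := hUy
  refine ⟨a, ?_, ?_⟩
  · have h1 : ⟪a, a⟫ ≤ ‖a‖ * R := by
      refine le_of_tendsto (ha a) ?_
      filter_upwards [hbd] with z hz
      exact (real_inner_le_norm _ _).trans (by gcongr)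
    rw [real_inner_self_eq_norm_mul_norm] at h1
    rcases (norm_nonneg a).eq_or_lt with h0 | h0
    · obtain ⟨z, hz⟩ := hbd.exists
      rw [← h0]
      exact (norm_nonneg _).trans hz
    · exact le_of_mul_le_mul_left h1 h0
  · refine add_le_of_eventually (l := (U : Filter H₂)) tendsto_const_nhds
      (fun r hr => hg.eventually_lt ha hr)
      (fun r hr => hf.eventually_lt (x := fun z => L (u z) + z) (fun h => ?_) hr) ?_
    · simp only [inner_add_right, ← ContinuousLinearMap.adjoint_inner_left]
      exact (ha _).add (tendsto_const_nhds.inner hy')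
    · filter_upwards [hU] with z hz using (hu z hz).2

/-- Baire category: rescaled copies of these closed sets cover the space, so one of the sets is a
neighbourhood of some x₀. Convexity then moves the neighbourhood to 0. -/
theorem exists_boundedPerturbations_mem_nhds (hg : IsProperConvexLSC g) (hf : IsProperConvexLSC f)
    (h : (0 : H₂) ∈ interior (L '' effDom g - effDom f)) :
    ∃ n : ℕ, boundedPerturbations g f L n ∈ 𝓝 (0 : H₂) := by
  rw [mem_interior_iff_mem_nhds] at h
  have hcov : ∀ x : H₂, ∀ᶠ t : ℝ in 𝓝 0, ∃ n : ℕ, t • x ∈ boundedPerturbations g f L n := by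
    intro x
    have : Tendsto (fun t : ℝ => -(t • x)) (𝓝 0) (𝓝 0) := by
      have : Continuous fun t : ℝ => -(t • x) := by fun_prop
      simpa using this.tendsto 0
    filter_upwards [this.eventually h] with t ht using exists_mem_boundedPerturbations hg hf ht
  have hunion : ⋃ i : ℕ × ℕ, {x : H₂ | ((i.1 : ℝ) + 1)⁻¹ • x ∈ boundedPerturbations g f L i.2} =
      Set.univ := by
    refine Set.eq_univ_of_forall fun x => ?_
    have ht : Tendsto (fun m : ℕ => ((m : ℝ) + 1)⁻¹) atTop (𝓝 0) := by
      simpa using tendsto_one_div_add_atTop_nhds_zero_nat (𝕜 := ℝ)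
    obtain ⟨m, n, hn⟩ := (ht.eventually (hcov x)).exists
    exact Set.mem_iUnion.2 ⟨(m, n), hn⟩
  obtain ⟨⟨m, n⟩, x, hx⟩ := nonempty_interior_of_iUnion_of_closed (fun i : ℕ × ℕ =>
    (isClosed_boundedPerturbations hg hf (i.2 : ℝ)).preimage
      (continuous_const_smul ((i.1 : ℝ) + 1)⁻¹)) hunion
  have hm : ((m : ℝ) + 1)⁻¹ ≠ 0 := by positivity
  rw [mem_interior_iff_mem_nhds] at hx
  obtain ⟨x₀, hx₀⟩ : ∃ x₀, boundedPerturbations g f L n ∈ 𝓝 x₀ := by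
    refine ⟨((m : ℝ) + 1)⁻¹ • x, ?_⟩
    have : Tendsto (fun z : H₂ => ((m : ℝ) + 1)⁻¹⁻¹ • z) (𝓝 (((m : ℝ) + 1)⁻¹ • x)) (𝓝 x) := by
      have h1 := (continuous_const_smul ((m : ℝ) + 1)⁻¹⁻¹).tendsto (((m : ℝ) + 1)⁻¹ • x)
      rwa [inv_smul_smul₀ hm] at h1
    filter_upwards [this.eventually hx] with z hz
    have hz : ((m : ℝ) + 1)⁻¹ • ((m : ℝ) + 1)⁻¹⁻¹ • z ∈ boundedPerturbations g f L n := hz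
    rwa [smul_inv_smul₀ hm] at hz
  -- A small point opposite to x₀ is also a bounded perturbation; averaging it with the
  -- neighbourhood of x₀, with weights 1/(1+t) and t/(1+t), gives a neighbourhood of 0.
  have hneg : ∀ᶠ t : ℝ in 𝓝[>] 0, ∃ k : ℕ, (-t) • x₀ ∈ boundedPerturbations g f L k := by
    have : Tendsto (fun t : ℝ => -t) (𝓝[>] 0) (𝓝 0) := by
      simpa using (continuous_neg.tendsto (0 : ℝ)).mono_left nhdsWithin_le_nhds
    exact this.eventually (hcov x₀)
  obtain ⟨t, ⟨k, hk⟩, ht⟩ := (hneg.and self_mem_nhdsWithin).exists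
  have ht : 0 < t := ht
  refine ⟨max n k, ?_⟩
  have hc := convex_boundedPerturbations (L := L) hg hf ((max n k : ℕ) : ℝ)
  have hn' : boundedPerturbations g f L n ⊆ boundedPerturbations g f L ((max n k : ℕ) : ℝ) :=
    boundedPerturbations_mono (by exact_mod_cast le_max_left n k)
  have hk' := boundedPerturbations_mono (g := g) (f := f) (L := L)
    (show (k : ℝ) ≤ ((max n k : ℕ) : ℝ) by exact_mod_cast le_max_right n k) hk
  have hlim : Tendsto (fun y : H₂ => ((1 + t) / t) • y + x₀) (𝓝 0) (𝓝 x₀) := by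
    have : Continuous fun y : H₂ => ((1 + t) / t) • y + x₀ := by fun_prop
    simpa using this.tendsto 0
  filter_upwards [hlim.eventually hx₀] with y hy
  have := hc (hn' hy) hk' (a := t / (1 + t)) (b := 1 / (1 + t)) (by positivity) (by positivity)
    (by field_simp; ring)
  convert this using 1
  rw [smul_add, smul_smul, smul_smul, add_assoc, ← add_smul]
  have h1 : t / (1 + t) * ((1 + t) / t) = 1 := by field_simp
  have h2 : t / (1 + t) + 1 / (1 + t) * -t = 0 := by ring
  rw [h1, h2, one_smul, zero_smul, add_zero]

/-- Under the regularity condition every primal solution has a multiplier. -/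
theorem exists_isSaddle (hg : IsProperConvexLSC g) (hf : IsProperConvexLSC f)
    (h : (0 : H₂) ∈ interior (L '' effDom g - effDom f)) {u : H₁}
    (hu : IsMinimizer (primalObjective g f L) u) : ∃ p, IsSaddle g f L u p := by
  obtain ⟨n, hn⟩ := exists_boundedPerturbations_mem_nhds hg hf h
  have hgu : g u ≠ ⊤ := fun hT => hu.1 (by
    rw [primalObjective, hT, EReal.top_add_of_ne_bot (hf.ne_bot _)])
  have hfu : f (L u) ≠ ⊤ := fun hT => hu.1 (by
    rw [primalObjective, hT, EReal.add_top_of_ne_bot (hg.ne_bot _)])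
  have hr := (EReal.coe_toReal hgu (hg.ne_bot u)).symm
  have hs := (EReal.coe_toReal hfu (hf.ne_bot _)).symm
  set r := (g u).toReal
  set s := (f (L u)).toReal
  -- E is essentially the epigraph of the value function of the perturbed problem; the multiplier is
  -- a subgradient of that function at 0.
  let E : Set (H₂ × ℝ) := {q | ∃ v, g v + f (L v + q.1) ≤ (q.2 : EReal)}
  have hE : Convex ℝ E := by
    rintro ⟨y, t⟩ ⟨v, hv⟩ ⟨z, t'⟩ ⟨w, hw⟩ a b ha hb hab
    exact ⟨a • v + b • w, perturbed_convex_combination_le hg hf hv hw ha hb hab⟩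
  have hnhds : ∀ t : ℝ, (n : ℝ) < t → E ∈ 𝓝 ((0 : H₂), t) := by
    intro t ht
    filter_upwards [prod_mem_nhds hn (lt_mem_nhds ht)] with q hq
    obtain ⟨⟨v, -, hv⟩, hq2⟩ := hq
    exact ⟨v, hv.trans (EReal.coe_le_coe_iff.2 (le_of_lt hq2))⟩
  have hmin : ∀ t : ℝ, ((0 : H₂), t) ∈ E → r + s ≤ t := by
    rintro t ⟨v, hv⟩
    have := hu.2 v
    rw [primalObjective, primalObjective, hr, hs, ← EReal.coe_add] at this
    rw [add_zero] at hv
    exact EReal.coe_le_coe_iff.1 (this.trans hv)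
  have hnot : ((0 : H₂), r + s) ∉ interior E := by
    intro hmem
    rw [mem_interior_iff_mem_nhds] at hmem
    have h1 : Tendsto (fun ε : ℝ => ((0 : H₂), r + s - ε)) (𝓝[>] 0) (𝓝 ((0 : H₂), r + s)) := by
      have : Continuous fun ε : ℝ => ((0 : H₂), r + s - ε) := by fun_prop
      simpa using (this.tendsto 0).mono_left nhdsWithin_le_nhds
    obtain ⟨ε, h2, h3⟩ := ((h1.eventually hmem).and self_mem_nhdsWithin).exists
    have h3 : 0 < ε := h3
    linarith [hmin _ h2]
  have hint : (interior E).Nonempty :=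
    ⟨((0 : H₂), n + 1), mem_interior_iff_mem_nhds.2 (hnhds _ (by linarith))⟩
  obtain ⟨φ, hφ⟩ := geometric_hahn_banach_open_point hE.interior isOpen_interior hnot
  obtain ⟨q, σ, hqσ⟩ := exists_inner_add_mul φ
  have hle : ∀ x ∈ E, φ x ≤ φ (0, r + s) := by
    intro x hx
    have : x ∈ closure (interior E) := by
      rw [hE.closure_interior_eq_closure_of_nonempty_interior hint]
      exact subset_closure hx
    exact closure_minimal (fun a ha => (hφ a ha).le)
      (isClosed_le φ.continuous continuous_const) this
  -- The supporting hyperplane is not vertical because E has interior points straight above (0, r +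
  -- s).
  have hσ : σ < 0 := by
    set T : ℝ := max (n : ℝ) (r + s) + 1
    have h1 := hφ (0, T) (mem_interior_iff_mem_nhds.2
      (hnhds T (by linarith [le_max_left (n : ℝ) (r + s)])))
    rw [hqσ, hqσ] at h1
    have h2 : r + s < T := by linarith [le_max_right (n : ℝ) (r + s)]
    nlinarith
  -- The perturbation z - L v decouples the arguments of g and f: fixing z = L u gives the inclusion
  -- for g, fixing v = u the one for f.
  have key : ∀ v z (ρ τ : ℝ), g v = ρ → f z = τ →
      r + s + ⟪-σ⁻¹ • q, z - L v⟫ ≤ ρ + τ := by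
    intro v z ρ τ hv hz
    have h1 := hle (z - L v, ρ + τ) ⟨v, by
      simp only [add_sub_cancel, hv, hz, EReal.coe_add, le_refl]⟩
    rw [hqσ, hqσ, inner_zero_right, zero_add] at h1
    rw [real_inner_smul_left]
    have h2 : -σ⁻¹ * (⟪q, z - L v⟫ + σ * (ρ + τ)) ≤ -σ⁻¹ * (σ * (r + s)) :=
      mul_le_mul_of_nonneg_left h1 (by simpa using hσ.le)
    have h3 : -σ⁻¹ * (σ * (r + s)) = -(r + s) := by field_simp [hσ.ne]
    have h4 : -σ⁻¹ * (⟪q, z - L v⟫ + σ * (ρ + τ)) = -σ⁻¹ * ⟪q, z - L v⟫ - (ρ + τ) := by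
      field_simp [hσ.ne]
      ring
    linarith
  refine ⟨-σ⁻¹ • q, mem_subdifferential_iff.2 ⟨r, hr, fun v => ?_⟩,
    mem_subdifferential_iff.2 ⟨s, hs, fun z => ?_⟩⟩
  · induction hv : g v with
    | bot => exact absurd hv (hg.ne_bot v)
    | top => simp
    | coe ρ =>
      have := key v (L u) ρ s hv hs
      rw [EReal.coe_le_coe_iff, inner_neg_left, ContinuousLinearMap.adjoint_inner_left, map_sub,
        ← inner_neg_right, neg_sub]
      linarith
  · induction hz : f z with
    | bot => exact absurd hz (hf.ne_bot z)
    | top => simp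
    | coe τ =>
      have := key u z r τ hr hz
      rw [EReal.coe_le_coe_iff]
      linarith

end Duality

/-! ### Iterates of the algorithm: descent, weak limits, identification -/

section Algorithm

variable {H₁ H₂ : Type*}
  [NormedAddCommGroup H₁] [InnerProductSpace ℝ H₁]
  [NormedAddCommGroup H₂] [InnerProductSpace ℝ H₂] [CompleteSpace H₂]
  {g : H₁ → EReal} {f : H₂ → EReal} {L : H₁ →L[ℝ] H₂}

/-- Fermat's rule for a convex function plus a quadratic least-squares term. -/
theorem neg_smul_adjoint_mem_subdifferential [CompleteSpace H₁] (hg : IsProperConvexLSC g)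
    {lam : ℝ} {c : H₂} {u : H₁}
    (hu : IsMinimizer (fun v => g v + ((lam / 2 * ‖c + L v‖ ^ 2 : ℝ) : EReal)) u) :
    -(ContinuousLinearMap.adjoint L (lam • (c + L u))) ∈ subdifferential g u := by
  have hgu : g u ≠ ⊤ := fun hT => hu.1 (by simp only [hT, EReal.top_add_coe])
  have hr := (EReal.coe_toReal hgu (hg.ne_bot u)).symm
  set r := (g u).toReal
  refine mem_subdifferential_iff.2 ⟨r, hr, fun y => ?_⟩
  induction hy : g y with
  | bot => exact absurd hy (hg.ne_bot y)
  | top => simp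
  | coe s =>
    rw [EReal.coe_le_coe_iff, inner_neg_left, ContinuousLinearMap.adjoint_inner_left,
      real_inner_smul_left]
    set w := c + L u
    set e := L (y - u)
    -- Compare u with (1 - t)u + ty and divide by t; the quadratic remainder vanishes as t → 0.
    have key : ∀ t : ℝ, 0 < t → t ≤ 1 →
        r - lam * ⟪w, e⟫ ≤ s + t * (lam / 2 * ‖e‖ ^ 2) := by
      intro t ht ht1
      have h1 := hg.convex_combination_le hr.le hy.le (sub_nonneg.2 ht1) ht.le (by ring)
      have h2 : g u + ((lam / 2 * ‖w‖ ^ 2 : ℝ) : EReal) ≤ _ := hu.2 ((1 - t) • u + t • y)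
      have h3 : c + L ((1 - t) • u + t • y) = w + t • e := by
        simp only [w, e, map_add, map_sub, map_smul, smul_sub, sub_smul, one_smul]
        abel
      simp only [h3] at h2
      have h4 := h2.trans (add_le_add_left h1 _)
      rw [hr, ← EReal.coe_add, ← EReal.coe_add, EReal.coe_le_coe_iff, norm_add_sq_real w,
        real_inner_smul_right, norm_smul, mul_pow, Real.norm_eq_abs, sq_abs] at h4
      have h5 : t * (r - lam * ⟪w, e⟫) ≤ t * (s + t * (lam / 2 * ‖e‖ ^ 2)) := by linarith
      exact le_of_mul_le_mul_left h5 ht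
    have hlim : Tendsto (fun t : ℝ => s + t * (lam / 2 * ‖e‖ ^ 2)) (𝓝[>] 0) (𝓝 s) := by
      have : Continuous fun t : ℝ => s + t * (lam / 2 * ‖e‖ ^ 2) := by fun_prop
      simpa using (this.tendsto 0).mono_left nhdsWithin_le_nhds
    have := ge_of_tendsto hlim (b := r - lam * ⟪w, e⟫) (by
      filter_upwards [Ioc_mem_nhdsGT (zero_lt_one (α := ℝ))] with t ht using key t ht.1 ht.2)
    linarith

variable {lam : ℝ} {u : ℕ → H₁} {d b : ℕ → H₂}

theorem IsAlternatingSplitBregman.mem_subdifferential_right (hf : IsProperConvexLSC f)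
    (hrun : IsAlternatingSplitBregman g f L lam u d b) (k : ℕ) :
    lam • b (k + 1) ∈ subdifferential f (d (k + 1)) := by
  -- The d-step has the same least-squares form, with -id in place of L.
  have h := neg_smul_adjoint_mem_subdifferential (L := -ContinuousLinearMap.id ℝ H₂) (lam := lam)
    (c := b k + L (u (k + 1))) hf (u := d (k + 1)) (by
      have := hrun.d_step k
      simpa [← sub_eq_add_neg] using this)
  have h2 : b k + L (u (k + 1)) + (-ContinuousLinearMap.id ℝ H₂) (d (k + 1)) = b (k + 1) := by
    rw [hrun.b_step]
    simp [sub_eq_add_neg]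
  rw [h2] at h
  convert h using 1
  refine ext_inner_right ℝ fun v => ?_
  rw [inner_neg_left, ContinuousLinearMap.adjoint_inner_left]
  simp

variable [CompleteSpace H₁]

theorem IsAlternatingSplitBregman.mem_subdifferential_left (hg : IsProperConvexLSC g)
    (hrun : IsAlternatingSplitBregman g f L lam u d b) (k : ℕ) :
    -(ContinuousLinearMap.adjoint L (lam • (b k + (L (u (k + 1)) - d k)))) ∈
      subdifferential g (u (k + 1)) := by
  have h := neg_smul_adjoint_mem_subdifferential (L := L) (lam := lam) (c := b k - d k) hg
    (u := u (k + 1)) (by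
      have := hrun.u_step k
      simpa only [add_sub_right_comm] using this)
  convert h using 4
  abel

/-- The squared distance of `(b k, d k)` to a primal-dual solution decreases by at least the
squared residual. -/
theorem IsAlternatingSplitBregman.fejer (hlam : 0 < lam) (hg : IsProperConvexLSC g)
    (hf : IsProperConvexLSC f) (hrun : IsAlternatingSplitBregman g f L lam u d b)
    {v : H₁} {c : H₂} (hs : IsSaddle g f L v (lam • c)) (k : ℕ) :
    ‖b (k + 1) - c‖ ^ 2 + ‖d (k + 1) - L v‖ ^ 2 + ‖d k - L (u (k + 1))‖ ^ 2 ≤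
      ‖b k - c‖ ^ 2 + ‖d k - L v‖ ^ 2 := by
  have h1 := inner_sub_nonneg_of_mem_subdifferential (hrun.mem_subdifferential_left hg k) hs.left
  have h2 := inner_sub_nonneg_of_mem_subdifferential (hrun.mem_subdifferential_right hf k) hs.right
  rw [neg_sub_neg, ← map_sub, ← smul_sub, ContinuousLinearMap.adjoint_inner_left,
    real_inner_smul_left, map_sub] at h1
  rw [← smul_sub, real_inner_smul_left] at h2
  replace h1 := nonneg_of_mul_nonneg_right h1 hlam
  replace h2 := nonneg_of_mul_nonneg_right h2 hlam
  set r := L (u (k + 1)) - d k with hr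
  have e1 : c - (b k + r) = -((b k - c) + r) := by abel
  have e2 : L (u (k + 1)) - L v = (d k - L v) + r := by rw [hr]; abel
  have e3 : d k - L (u (k + 1)) = -r := by rw [hr]; abel
  have e4 : b (k + 1) - c = (b k - c) + (d k - L v) + r - (d (k + 1) - L v) := by
    rw [hrun.b_step, hr]; abel
  rw [e1, e2] at h1
  rw [e4] at h2
  rw [e3, e4]
  -- Now h1 reads 0 ≤ -⟪a + r, e + r⟫ and h2 reads 0 ≤ ⟪a + e + r - e', e'⟫; the right side of the
  -- goal minus the left is exactly twice their sum.
  generalize b k - c = a at *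
  generalize d k - L v = e at *
  generalize d (k + 1) - L v = e' at *
  simp only [← real_inner_self_eq_norm_sq, inner_add_left, inner_add_right, inner_sub_left,
    inner_sub_right, inner_neg_left, inner_neg_right] at *
  linarith [real_inner_comm a e, real_inner_comm a e', real_inner_comm e e', real_inner_comm a r,
    real_inner_comm e r, real_inner_comm e' r]

/-- Weak limits of the iterates along a filter are primal-dual solutions. -/
theorem IsAlternatingSplitBregman.exists_isSaddle_of_weak_limit
    (hg : IsProperConvexLSC g) (hf : IsProperConvexLSC f) (hchain : ChainRule g L)
    (hrun : IsAlternatingSplitBregman g f L lam u d b)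
    (hres : Tendsto (fun k => L (u (k + 1)) - d k) atTop (𝓝 0)) {R : ℝ} (hb : ∀ k, ‖b k‖ ≤ R)
    (hd : ∀ k, ‖d k‖ ≤ R)
    {l : Filter ℕ} [l.NeBot] (hl : l ≤ atTop) {bhat dhat : H₂}
    (hbl : ∀ h, Tendsto (fun k => ⟪h, b k⟫) l (𝓝 ⟪h, bhat⟫))
    (hdl : ∀ h, Tendsto (fun k => ⟪h, d k⟫) l (𝓝 ⟪h, dhat⟫)) :
    ∃ v, L v = dhat ∧ IsSaddle g f L v (lam • bhat) := by
  set G := conjugateCompNegAdjoint g L with hG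
  set r : ℕ → H₂ := fun k => L (u (k + 1)) - d k with hr
  have hrl : Tendsto r l (𝓝 0) := hres.mono_left hl
  have hLu : ∀ k, L (u (k + 1)) = d k + r k := fun k => by simp [hr]
  have hGle : ∀ p k (P : ℝ), G p = P → G (lam • (b k + r k)) ≤
      ((P + ⟪p, d k + r k⟫ - lam * ⟪b k + r k, d k + r k⟫ : ℝ) : EReal) := by
    intro p k P hP
    have h1 := hrun.mem_subdifferential_left hg k
    obtain ⟨γ, hγ, -⟩ := mem_subdifferential_iff.1 h1
    have h2 := le_conjugate_of_eq hγ (-(ContinuousLinearMap.adjoint L p))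
    change _ ≤ G p at h2
    have h3 : G (lam • (b k + r k)) = _ := conjugate_eq_of_mem_subdifferential hγ h1
    rw [hP, EReal.coe_le_coe_iff, inner_neg_left, ContinuousLinearMap.adjoint_inner_left,
      hLu] at h2
    rw [h3, EReal.coe_le_coe_iff, inner_neg_left, ContinuousLinearMap.adjoint_inner_left,
      real_inner_smul_left, hLu]
    linarith
  -- Index 0 is excluded: the initial values need not satisfy the subgradient inclusion.
  have hfle : ∀ x k (X : ℝ), 1 ≤ k → f x = X →
      f (d k) ≤ ((X - lam * ⟪b k, x - d k⟫ : ℝ) : EReal) := by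
    intro x k X hk hX
    obtain ⟨j, rfl⟩ := Nat.exists_eq_add_of_le' hk
    obtain ⟨φ, hφ, h1⟩ := mem_subdifferential_iff.1 (hrun.mem_subdifferential_right hf j)
    have h2 := h1 x
    rw [hX, EReal.coe_le_coe_iff, real_inner_smul_left] at h2
    rw [hφ, EReal.coe_le_coe_iff]
    linarith
  -- Both inclusions in one inequality: p = λb̂ leaves the one for f, x = d̂ the one for G.
  have key : ∀ x p (X P : ℝ), f x = X → G p = P → f dhat + G (lam • bhat) ≤
      ((X + P - lam * ⟪x, bhat⟫ + ⟪p, dhat⟫ : ℝ) : EReal) := by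
    intro x p X P hX hP
    have hbdd : ∀ {z : ℕ → H₂}, (∀ k, ‖z k‖ ≤ R) → Tendsto (fun k => ⟪z k, r k⟫) l (𝓝 0) := by
      intro z hz
      have h0 : Tendsto (fun k => R * ‖r k‖) l (𝓝 0) := by
        simpa using hrl.norm.const_mul R
      refine squeeze_zero_norm (fun k => ?_) h0
      exact (norm_inner_le_norm _ _).trans (by gcongr; exact hz k)
    have hrr : Tendsto (fun k => ⟪r k, r k⟫) l (𝓝 0) := by
      simpa using hrl.inner (𝕜 := ℝ) hrl
    have hpr : Tendsto (fun k => ⟪p, r k⟫) l (𝓝 0) := by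
      simpa using (tendsto_const_nhds (x := p)).inner (𝕜 := ℝ) hrl
    have hc : Tendsto (fun k => X + P - lam * ⟪x, b k⟫ + (⟪p, d k⟫ + ⟪p, r k⟫)
        - lam * (⟪b k, r k⟫ + ⟪d k, r k⟫ + ⟪r k, r k⟫)) l
        (𝓝 (X + P - lam * ⟪x, bhat⟫ + (⟪p, dhat⟫ + 0) - lam * (0 + 0 + 0))) :=
      ((((hbl x).const_mul lam).const_sub (X + P)).add ((hdl p).add hpr)).sub
        ((((hbdd hb).add (hbdd hd)).add hrr).const_mul lam)
    simp only [add_zero, mul_zero, sub_zero] at hc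
    have hw : ∀ h, Tendsto (fun k => ⟪h, -(ContinuousLinearMap.adjoint L (lam • (b k + r k)))⟫) l
        (𝓝 ⟪h, -(ContinuousLinearMap.adjoint L (lam • bhat))⟫) := by
      intro h
      simp only [inner_neg_right, ContinuousLinearMap.adjoint_inner_right, real_inner_smul_right,
        inner_add_right]
      have h1 : Tendsto (fun k => ⟪L h, r k⟫) l (𝓝 0) := by
        simpa using (tendsto_const_nhds (x := L h)).inner (𝕜 := ℝ) hrl
      simpa using (((hbl (L h)).add h1).const_mul lam).neg
    refine add_le_of_eventually hc (fun s hs => hf.eventually_lt hdl hs)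
      (fun s hs => eventually_lt_conjugate hg.ne_bot hw hs) ?_
    filter_upwards [hl (eventually_ge_atTop 1)] with k hk
    refine (add_le_add (hfle x k X hk hX) (hGle p k P hP)).trans (le_of_eq ?_)
    rw [← EReal.coe_add, EReal.coe_eq_coe_iff]
    simp only [inner_add_left, inner_add_right, inner_sub_right]
    rw [real_inner_comm (b k) x, real_inner_comm (r k) (d k)]
    ring
  have hGbot : ∀ p, G p ≠ ⊥ := fun p => conjugate_ne_bot hg _
  obtain ⟨x₀, hx₀⟩ := hf.exists_ne_top
  obtain ⟨γ, hγ, -⟩ := mem_subdifferential_iff.1 (hrun.mem_subdifferential_left hg 0)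
  -- One instance of `key` with finite data shows that f d̂ and G(λb̂) are finite, which the
  -- cancellations below need.
  obtain ⟨X, P, hX, hP, -⟩ := exists_coe_of_add_le (hf.ne_bot dhat) (hGbot (lam • bhat))
    (key x₀ _ _ _ (EReal.coe_toReal hx₀ (hf.ne_bot x₀)).symm
      (conjugate_eq_of_mem_subdifferential hγ (hrun.mem_subdifferential_left hg 0)))
  have hright : lam • bhat ∈ subdifferential f dhat := by
    refine mem_subdifferential_iff.2 ⟨X, hX, fun y => ?_⟩
    induction hy : f y with
    | bot => exact absurd hy (hf.ne_bot y)
    | top => simp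
    | coe t =>
      have := key y _ t P hy hP
      rw [hX, hP, ← EReal.coe_add, EReal.coe_le_coe_iff, real_inner_smul_left] at this
      rw [EReal.coe_le_coe_iff, real_inner_smul_left, inner_sub_right, real_inner_comm]
      linarith
  have hleft : -dhat ∈ subdifferential G (lam • bhat) := by
    refine mem_subdifferential_iff.2 ⟨P, hP, fun q => ?_⟩
    induction hq : G q with
    | bot => exact absurd hq (hGbot q)
    | top => simp
    | coe t =>
      have := key dhat q X t hX hq
      rw [hX, hP, ← EReal.coe_add, EReal.coe_le_coe_iff] at this
      rw [EReal.coe_le_coe_iff, inner_neg_left, inner_sub_right, real_inner_smul_right,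
        real_inner_comm q]
      linarith
  -- The chain rule supplies the preimage of d̂ under L, without any limit of the u k.
  rw [hG, hchain] at hleft
  obtain ⟨v, hv, hLv⟩ := hleft
  have hLv : L v = dhat := neg_injective hLv
  exact ⟨v, hLv, hg.mem_subdifferential_of_conjugate hv, hLv ▸ hright⟩

theorem IsAlternatingSplitBregman.tendsto_dist (hlam : 0 < lam) (hg : IsProperConvexLSC g)
    (hf : IsProperConvexLSC f) (hrun : IsAlternatingSplitBregman g f L lam u d b)
    {v : H₁} {c : H₂} (hs : IsSaddle g f L v (lam • c)) :
    ∃ m, Tendsto (fun k => ‖b k - c‖ ^ 2 + ‖d k - L v‖ ^ 2) atTop (𝓝 m) :=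
  ⟨_, tendsto_atTop_ciInf
    (antitone_nat_of_succ_le fun k => by
      linarith [hrun.fejer hlam hg hf hs k, sq_nonneg ‖d k - L (u (k + 1))‖])
    ⟨0, by rintro _ ⟨k, rfl⟩; positivity⟩⟩

theorem IsAlternatingSplitBregman.sum_residual_le (hlam : 0 < lam) (hg : IsProperConvexLSC g)
    (hf : IsProperConvexLSC f) (hrun : IsAlternatingSplitBregman g f L lam u d b)
    {v : H₁} {c : H₂} (hs : IsSaddle g f L v (lam • c)) (n : ℕ) :
    ‖b n - c‖ ^ 2 + ‖d n - L v‖ ^ 2 + ∑ k ∈ Finset.range n, ‖d k - L (u (k + 1))‖ ^ 2 ≤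
      ‖b 0 - c‖ ^ 2 + ‖d 0 - L v‖ ^ 2 := by
  induction n with
  | zero => simp
  | succ n ih =>
    rw [Finset.sum_range_succ]
    linarith [hrun.fejer hlam hg hf hs n]

theorem IsAlternatingSplitBregman.summable_residual (hlam : 0 < lam) (hg : IsProperConvexLSC g)
    (hf : IsProperConvexLSC f) (hrun : IsAlternatingSplitBregman g f L lam u d b)
    {v : H₁} {c : H₂} (hs : IsSaddle g f L v (lam • c)) :
    Summable fun k => ‖d k - L (u (k + 1))‖ ^ 2 :=
  summable_of_sum_range_le (c := ‖b 0 - c‖ ^ 2 + ‖d 0 - L v‖ ^ 2) (fun _ => sq_nonneg _) fun n => by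
    linarith [hrun.sum_residual_le hlam hg hf hs n, sq_nonneg ‖b n - c‖, sq_nonneg ‖d n - L v‖]

theorem IsAlternatingSplitBregman.exists_norm_le (hlam : 0 < lam) (hg : IsProperConvexLSC g)
    (hf : IsProperConvexLSC f) (hrun : IsAlternatingSplitBregman g f L lam u d b)
    {v : H₁} {c : H₂} (hs : IsSaddle g f L v (lam • c)) :
    ∃ R, (∀ k, ‖b k‖ ≤ R) ∧ ∀ k, ‖d k‖ ≤ R := by
  set V := ‖b 0 - c‖ ^ 2 + ‖d 0 - L v‖ ^ 2
  have hsum := hrun.sum_residual_le hlam hg hf hs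
  have hnn : ∀ n, 0 ≤ ∑ k ∈ Finset.range n, ‖d k - L (u (k + 1))‖ ^ 2 := fun n =>
    Finset.sum_nonneg fun _ _ => sq_nonneg _
  refine ⟨√V + ‖c‖ + ‖L v‖, fun k => ?_, fun k => ?_⟩
  · have h1 : ‖b k - c‖ ≤ √V :=
      Real.le_sqrt_of_sq_le (by linarith [hsum k, hnn k, sq_nonneg ‖d k - L v‖])
    linarith [norm_le_norm_sub_add (b k) c, norm_nonneg (L v)]
  · have h1 : ‖d k - L v‖ ≤ √V :=
      Real.le_sqrt_of_sq_le (by linarith [hsum k, hnn k, sq_nonneg ‖b k - c‖])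
    linarith [norm_le_norm_sub_add (d k) (L v), norm_nonneg c]

/-- The iterates `b k`, `d k` converge weakly, and the limits come from a primal-dual solution. -/
theorem IsAlternatingSplitBregman.exists_weak_limit (hlam : 0 < lam) (hg : IsProperConvexLSC g)
    (hf : IsProperConvexLSC f) (hchain : ChainRule g L)
    (hrun : IsAlternatingSplitBregman g f L lam u d b)
    (hres : Tendsto (fun k => L (u (k + 1)) - d k) atTop (𝓝 0)) {R : ℝ} (hb : ∀ k, ‖b k‖ ≤ R)
    (hd : ∀ k, ‖d k‖ ≤ R) :
    ∃ (v : H₁) (c : H₂), IsSaddle g f L v (lam • c) ∧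
      (∀ h, Tendsto (fun k => ⟪h, b k⟫) atTop (𝓝 ⟪h, c⟫)) ∧
      ∀ h, Tendsto (fun k => ⟪h, d k⟫) atTop (𝓝 ⟪h, L v⟫) := by
  have hlim : ∀ U : Ultrafilter ℕ, (U : Filter ℕ) ≤ atTop → ∃ (v : H₁) (c : H₂),
      IsSaddle g f L v (lam • c) ∧
      (∀ h, Tendsto (fun k => ⟪h, b k⟫) U (𝓝 ⟪h, c⟫)) ∧
      ∀ h, Tendsto (fun k => ⟪h, d k⟫) U (𝓝 ⟪h, L v⟫) := by
    intro U hU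
    obtain ⟨c, hc⟩ := SplitBregman.exists_weak_limit U (Eventually.of_forall hb)
    obtain ⟨e, he⟩ := SplitBregman.exists_weak_limit U (Eventually.of_forall hd)
    obtain ⟨v, rfl, hs⟩ := hrun.exists_isSaddle_of_weak_limit hg hf hchain hres hb hd hU hc he
    exact ⟨v, c, hs, hc, he⟩
  obtain ⟨v, c, hs, hc, he⟩ := hlim _ (Ultrafilter.of_le atTop)
  -- Opial's lemma compares every ultrafilter limit with the one fixed above, so the whole sequence
  -- converges.
  have huniq : ∀ U : Ultrafilter ℕ, (U : Filter ℕ) ≤ atTop →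
      (∀ h, Tendsto (fun k => ⟪h, b k⟫) U (𝓝 ⟪h, c⟫)) ∧
      ∀ h, Tendsto (fun k => ⟪h, d k⟫) U (𝓝 ⟪h, L v⟫) := by
    intro U hU
    obtain ⟨v', c', hs', hc', he'⟩ := hlim U hU
    obtain ⟨m, hm⟩ := hrun.tendsto_dist hlam hg hf hs
    obtain ⟨m', hm'⟩ := hrun.tendsto_dist hlam hg hf hs'
    obtain ⟨h1, h2⟩ := weak_limit_unique (Ultrafilter.of_le atTop) hU hc he hc' he' hm hm'
    rw [h1, h2]
    exact ⟨hc', he'⟩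
  exact ⟨v, c, hs, fun h => (tendsto_iff_ultrafilter _ _ _).2 fun U hU => (huniq U hU).1 h,
    fun h => (tendsto_iff_ultrafilter _ _ _).2 fun U hU => (huniq U hU).2 h⟩

/-- Weak cluster points of the primal iterates are mapped by `L` to the weak limit of `d k`. -/
theorem IsWeakClusterPt.map_eq_of_residual {a : H₁} {e : H₂} (ha : IsWeakClusterPt u a)
    (hres : Tendsto (fun k => L (u (k + 1)) - d k) atTop (𝓝 0))
    (hd : ∀ h, Tendsto (fun k => ⟪h, d k⟫) atTop (𝓝 ⟪h, e⟫)) : L a = e := by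
  refine ext_inner_left ℝ fun h => ?_
  have h1 := ha.mapClusterPt_inner (ContinuousLinearMap.adjoint L h)
  simp only [ContinuousLinearMap.adjoint_inner_left] at h1
  have h2 : Tendsto (fun k => ⟪h, L (u k)⟫) atTop (𝓝 ⟪h, e⟫) := by
    -- The residual pairs u (k + 1) with d k, hence the shift.
    rw [← tendsto_add_atTop_iff_nat 1]
    have h3 : Tendsto (fun k => ⟪h, L (u (k + 1)) - d k⟫) atTop (𝓝 0) := by
      simpa using (tendsto_const_nhds (x := h)).inner (𝕜 := ℝ) hres
    have h4 := (hd h).add h3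
    simp only [← inner_add_right, add_sub_cancel, add_zero] at h4
    exact h4
  obtain ⟨U, hU, h3⟩ := mapClusterPt_iff_ultrafilter.1 h1
  exact tendsto_nhds_unique h3 (h2.mono_left hU)

end Algorithm

end SplitBregman

theorem theorem2p6 {H₁ H₂ : Type*}
    [NormedAddCommGroup H₁] [InnerProductSpace ℝ H₁] [CompleteSpace H₁]
    [NormedAddCommGroup H₂] [InnerProductSpace ℝ H₂] [CompleteSpace H₂]
    (g : H₁ → EReal) (f : H₂ → EReal) (L : H₁ →L[ℝ] H₂) (lam : ℝ) (hlam : 0 < lam)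
    (hg : SplitBregman.IsProperConvexLSC g) (hf : SplitBregman.IsProperConvexLSC f)
    (hreg : SplitBregman.RegularityCondition g f L)
    (hP : ∃ u, SplitBregman.IsMinimizer (SplitBregman.primalObjective g f L) u)
    (hD : ∃ p, SplitBregman.IsMinimizer (SplitBregman.dualObjective g f L) p)
    (hchain : SplitBregman.ChainRule g L)
    (u : ℕ → H₁) (d b : ℕ → H₂)
    (hrun : SplitBregman.IsAlternatingSplitBregman g f L lam u d b) :
    ∃ dhat bhat : H₂,
      SplitBregman.WeaklyConverges d dhat ∧
      SplitBregman.WeaklyConverges b bhat ∧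
      SplitBregman.IsMinimizer (SplitBregman.dualObjective g f L) (lam • bhat) ∧
      Tendsto (fun k => d k - L (u (k + 1))) atTop (𝓝 0) ∧
      Summable (fun k => ‖d k - L (u (k + 1))‖ ^ 2) ∧
      ∃ uhat : H₁, L uhat = dhat ∧
        SplitBregman.IsMinimizer (SplitBregman.primalObjective g f L) uhat ∧
        (Function.Injective L →
          ∀ ubar : H₁, SplitBregman.IsWeakClusterPt u ubar → ubar = uhat) := by
  obtain ⟨u₀, hu₀⟩ := hP
  obtain ⟨p₀, hs₀⟩ := SplitBregman.exists_isSaddle hg hf hreg.mem_interior hu₀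
  -- Multipliers correspond to λ times the b-variable, so p₀ is rewritten in that form.
  rw [← smul_inv_smul₀ hlam.ne' p₀] at hs₀
  have hsum := hrun.summable_residual hlam hg hf hs₀
  have hres : Tendsto (fun k => d k - L (u (k + 1))) atTop (𝓝 0) := by
    rw [tendsto_zero_iff_norm_tendsto_zero]
    simpa using hsum.tendsto_atTop_zero.sqrt
  have hres' : Tendsto (fun k => L (u (k + 1)) - d k) atTop (𝓝 0) := by
    simpa using hres.neg
  obtain ⟨R, hb, hd⟩ := hrun.exists_norm_le hlam hg hf hs₀
  obtain ⟨v, c, hs, hbc, hdv⟩ := hrun.exists_weak_limit hlam hg hf hchain hres' hb hd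
  exact ⟨L v, c, SplitBregman.weaklyConverges_of_forall_inner hdv,
    SplitBregman.weaklyConverges_of_forall_inner hbc, hs.isMinimizer_dual, hres, hsum, v, rfl,
    hs.isMinimizer_primal, fun hinj _ ha => hinj (ha.map_eq_of_residual hres' hdv)⟩
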